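/- Let $d \ge 2$ and $n$ be integers. For a homogeneous form $G \in \mathbb{Z}[x_1,\dots,x_n]$ of degree $d$, write $$G(\mathbf{x}) = \sum_{j_1,\dots,j_d=1}^n G_{\mathbf{j}}\, x_{j_1}\cdots x_{j_d}$$ with $G_{\mathbf{j}} \in \mathbb{Q}$ symmetric in $\mathbf{j} = (j_1,\dots,j_d)$, and define the multilinear form associated to $G$ by $$\Gamma_G(\mathbf{x}_1,\dots,\mathbf{x}_d) = d!\sum_{\mathbf{j}} G_{\mathbf{j}}\, x_{1,j_1}\cdots x_{d,j_d}.$$ Let $H_G(\mathbf{x}) = \left[\frac{\partial^2 G}{\partial x_i \partial x_j}(\mathbf{x})\right]_{1\le i,j\le n}$ be the Hessian matrix of $G$ (a constant matrix $H_G$ if $d=2$), and put $$\mathcal{H}_G = \begin{cases} \max_{0\le r\le n} \bigl( \dim\{\mathbf{x}\in\mathbb{A}^n_{\mathbb{C}} : \operatorname{rank} H_G(\mathbf{x}) \le r\} - r \bigr) & \text{if } d>2,\\ n - \operatorname{rank} H_G & \text{if } d=2.\end{cases}$$ Then there is a constant $C>0$ depending only on $d$ and $n$ such that, for every homogeneous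 form $G\in\mathbb{Z}[x_1,\dots,x_n]$ of degree $d$ and every real $B\ge 1$, $$\#\left\{(\mathbf{x}_1,\dots,\mathbf{x}_{d-1}) \in \left(([-B,B]\cap\mathbb{Z})^n\right)^{d-1} : \Gamma_G(\mathbf{x}_1,\dots,\mathbf{x}_{d-1},\mathbf{e}_i)=0 \ (1\le i\le n)\right\} \le C\, B^{(d-2)n+\mathcal{H}_G},$$ where $\mathbf{e}_1,\dots,\mathbf{e}_n$ is the standard basis. -/

import Mathlib

namespace HessianBirch

open MvPolynomial

noncomputable section

/-- The exponent vector of the monomial `x_{j_1} ⋯ x_{j_d}`. -/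
def monoExp {n d : ℕ} (j : Fin d → Fin n) : Fin n →₀ ℕ :=
  ∑ k, Finsupp.single (j k) 1

/-- The symmetric rational coefficients `G_j` with `G = ∑_j G_j x_{j_1} ⋯ x_{j_d}`: the coefficient
of a monomial in `G` is distributed equally among the index tuples that give this monomial.
See `symCoeff_comp_perm` and `sum_symCoeff`. -/
def symCoeff {n : ℕ} (G : MvPolynomial (Fin n) ℤ) (d : ℕ) (j : Fin d → Fin n) : ℚ :=
  ((G.coeff (monoExp j) : ℤ) : ℚ) /
    ((Finset.univ.filter fun j' : Fin d → Fin n => monoExp j' = monoExp j).card : ℚ)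

/-- The multilinear form `Γ_G (x_1, …, x_d) = d! ∑_j G_j x_{1, j_1} ⋯ x_{d, j_d}`, on vectors with
entries in any `ℚ`-algebra. -/
def polarForm {n : ℕ} (G : MvPolynomial (Fin n) ℤ) (d : ℕ) {K : Type*} [CommRing K] [Algebra ℚ K]
    (x : Fin d → Fin n → K) : K :=
  (d.factorial : K) * ∑ j : Fin d → Fin n, algebraMap ℚ K (symCoeff G d j) * ∏ k, x k (j k)

/-- The Hessian matrix `H_G(x)` of `G` at a complex point `x`. -/
def hessian {n : ℕ} (G : MvPolynomial (Fin n) ℤ) (x : Fin n → ℂ) : Matrix (Fin n) (Fin n) ℂ :=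
  Matrix.of fun i j => aeval x (pderiv i (pderiv j G))

/-- The set of `x ∈ 𝔸ⁿ(ℂ)` with `rank H_G(x) ≤ r`. -/
def rankLocus {n : ℕ} (G : MvPolynomial (Fin n) ℤ) (r : ℕ) : Set (Fin n → ℂ) :=
  {x | (hessian G x).rank ≤ r}

/-- The dimension of an algebraic set `Z ⊆ 𝔸ⁿ(ℂ)`: the Krull dimension of its coordinate ring
(`⊥` for the empty set). -/
def algDim {n : ℕ} (Z : Set (Fin n → ℂ)) : WithBot ℕ∞ :=
  ringKrullDim (MvPolynomial (Fin n) ℂ ⧸ vanishingIdeal ℂ Z)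

/-- The quantity `𝓗_G` of a form `G` of degree `d`:
`max_{0 ≤ r ≤ n} (dim {x | rank H_G(x) ≤ r} - r)` if `d > 2`, and `n - rank H_G` if `d = 2`.
If `d > 2` the sets are non-empty, as they contain `0`, so that their dimensions are natural
numbers (`exists_algDim_rankLocus_eq`). If `d = 2` the matrix `H_G(x)` does not depend on `x`
(`hessian_eq_of_two`), and it is evaluated at `x = 0`. -/
def hessDefect {n : ℕ} (G : MvPolynomial (Fin n) ℤ) (d : ℕ) : ℤ :=
  if 2 < d then
    (Finset.range (n + 1)).sup' Finset.nonempty_range_add_one fun r =>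
      (((algDim (rankLocus G r)).unbotD 0).toNat : ℤ) - (r : ℤ)
  else (n : ℤ) - ((hessian G 0).rank : ℤ)

/-- The tuple `(x_1, …, x_{d-1}, e_i)` of rational vectors, for integral vectors `x_k`. -/
def withBasisVec {n d : ℕ} (x : Fin (d - 1) → Fin n → ℤ) (i : Fin n) : Fin d → Fin n → ℚ :=
  fun k => if h : (k : ℕ) < d - 1 then fun l => (x ⟨k, h⟩ l : ℚ) else Pi.single i 1

/-- The set of `x_1, …, x_{d-1} ∈ ([-B, B] ∩ ℤ)ⁿ` with `Γ_G (x_1, …, x_{d-1}, e_i) = 0` for all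
`i`. It is finite (`solutionSet_finite`). -/
def solutionSet {n : ℕ} (G : MvPolynomial (Fin n) ℤ) (d : ℕ) (B : ℝ) :
    Set (Fin (d - 1) → Fin n → ℤ) :=
  {x | (∀ k l, -B ≤ (x k l : ℝ) ∧ (x k l : ℝ) ≤ B) ∧
    ∀ i : Fin n, polarForm G d (withBasisVec x i) = 0}

theorem monoExp_comp_perm {n d : ℕ} (j : Fin d → Fin n) (s : Equiv.Perm (Fin d)) :
    monoExp (j ∘ s) = monoExp j :=
  Equiv.sum_comp s fun k => Finsupp.single (j k) 1

theorem symCoeff_comp_perm {n d : ℕ} (G : MvPolynomial (Fin n) ℤ) (j : Fin d → Fin n)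
    (s : Equiv.Perm (Fin d)) : symCoeff G d (j ∘ s) = symCoeff G d j := by
  simp only [symCoeff, monoExp_comp_perm]

theorem exists_monoExp_eq {n d : ℕ} (m : Fin n →₀ ℕ) (hm : m.degree = d) :
    ∃ j : Fin d → Fin n, monoExp j = m := by
  subst hm
  have hl : m.toMultiset.toList.length = m.degree := by
    rw [Multiset.length_toList, Finsupp.card_toMultiset]; rfl
  refine ⟨fun k => m.toMultiset.toList[(k : ℕ)]'(by omega), ?_⟩
  apply (Function.LeftInverse.injective Finsupp.toMultiset_toFinsupp :
    Function.Injective (Finsupp.toMultiset (α := Fin n)))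
  have key : ∀ (l : List (Fin n)) (e : ℕ) (h : l.length = e),
      ∑ k : Fin e, ({l[(k : ℕ)]'(by omega)} : Multiset (Fin n)) = (l : Multiset (Fin n)) := by
    rintro l _ rfl
    rw [Fin.sum_univ_fun_getElem l fun a => ({a} : Multiset (Fin n)),
      ← Multiset.sum_map_singleton (l : Multiset (Fin n)), Multiset.map_coe, Multiset.sum_coe]
  rw [monoExp, map_sum]
  simp only [Finsupp.toMultiset_single, one_smul]
  rw [key _ _ hl, Multiset.coe_toList]

theorem sum_symCoeff {n d : ℕ} (G : MvPolynomial (Fin n) ℤ) (hG : G.IsHomogeneous d) :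
    ∑ j : Fin d → Fin n, C (symCoeff G d j) * ∏ k, X (j k) = map (Int.castRingHom ℚ) G := by
  classical
  have hm : ∀ j : Fin d → Fin n,
      C (symCoeff G d j) * ∏ k, X (j k) = monomial (monoExp j) (symCoeff G d j) := by
    intro j
    rw [monoExp, monomial_sum_index]
    rfl
  ext m
  simp only [hm, coeff_sum, coeff_monomial, coeff_map]
  rw [← Finset.sum_filter]
  have hc : ∀ j ∈ Finset.univ.filter (fun j : Fin d → Fin n => monoExp j = m), symCoeff G d j =
      ((G.coeff m : ℤ) : ℚ) /
        ((Finset.univ.filter fun j' : Fin d → Fin n => monoExp j' = m).card : ℚ) := by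
    intro j hj
    obtain rfl := (Finset.mem_filter.1 hj).2
    rfl
  rw [Finset.sum_congr rfl hc, Finset.sum_const, nsmul_eq_mul]
  by_cases hdeg : m.degree = d
  · obtain ⟨j, hj⟩ := exists_monoExp_eq m hdeg
    have h0 : ((Finset.univ.filter fun j' : Fin d → Fin n => monoExp j' = m).card : ℚ) ≠ 0 := by
      rw [Nat.cast_ne_zero]
      exact Finset.card_ne_zero_of_mem (Finset.mem_filter.2 ⟨Finset.mem_univ j, hj⟩)
    rw [mul_div_cancel₀ _ h0]
    rfl
  · rw [hG.coeff_eq_zero hdeg]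
    simp

theorem isHomogeneous_hessian {n d : ℕ} (G : MvPolynomial (Fin n) ℤ) (hG : G.IsHomogeneous d)
    (i j : Fin n) : (pderiv i (pderiv j G)).IsHomogeneous (d - 2) := by
  simpa [Nat.sub_sub] using (hG.pderiv (i := j)).pderiv (i := i)

theorem hessian_eq_of_two {n : ℕ} (G : MvPolynomial (Fin n) ℤ) (hG : G.IsHomogeneous 2)
    (x : Fin n → ℂ) : hessian G x = hessian G 0 := by
  ext i j
  have h := isHomogeneous_hessian G hG i j
  rw [Nat.sub_self, ← totalDegree_zero_iff_isHomogeneous, totalDegree_eq_zero_iff_eq_C] at h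
  simp only [hessian, Matrix.of_apply]
  rw [h]
  simp

theorem hessian_zero {n d : ℕ} (G : MvPolynomial (Fin n) ℤ) (hG : G.IsHomogeneous d)
    (hd : 2 < d) : hessian G 0 = 0 := by
  ext i j
  have h := isHomogeneous_hessian G hG i j
  simp only [hessian, Matrix.of_apply, Matrix.zero_apply]
  rw [aeval_zero, constantCoeff_eq, h.coeff_eq_zero (by simp; omega), map_zero]

theorem exists_algDim_rankLocus_eq {n d : ℕ} (G : MvPolynomial (Fin n) ℤ)
    (hG : G.IsHomogeneous d) (hd : 2 < d) (r : ℕ) :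
    ∃ m : ℕ, m ≤ n ∧ algDim (rankLocus G r) = (m : WithBot ℕ∞) := by
  have hle : algDim (rankLocus G r) ≤ (n : WithBot ℕ∞) := by
    refine (ringKrullDim_quotient_le _).trans ?_
    rw [MvPolynomial.ringKrullDim_of_isNoetherianRing, ringKrullDim_eq_zero_of_field]
    simp
  have hne : vanishingIdeal ℂ (rankLocus G r) ≠ ⊤ := by
    intro h
    have h1 : (1 : MvPolynomial (Fin n) ℂ) ∈ vanishingIdeal ℂ (rankLocus G r) := by
      rw [h]; trivial
    have h0 : (0 : Fin n → ℂ) ∈ rankLocus G r := by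
      simp [rankLocus, hessian_zero G hG hd]
    simpa using mem_vanishingIdeal_iff.1 h1 0 h0
  have hge : 0 ≤ algDim (rankLocus G r) := by
    have := Ideal.Quotient.nontrivial_iff.2 hne
    exact ringKrullDim_nonneg_of_nontrivial
  generalize algDim (rankLocus G r) = D at hle hge
  induction D with
  | bot => simp at hge
  | coe D =>
    have hle' : D ≤ (n : ℕ∞) := by exact_mod_cast hle
    obtain ⟨m, rfl⟩ := ENat.ne_top_iff_exists.1 (ne_top_of_le_ne_top (ENat.natCast_ne_top n) hle')
    exact ⟨m, by exact_mod_cast hle', rfl⟩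

theorem solutionSet_finite {n : ℕ} (G : MvPolynomial (Fin n) ℤ) (d : ℕ) (B : ℝ) :
    (solutionSet G d B).Finite := by
  refine (Set.Finite.pi' fun _ => Set.Finite.pi' fun _ =>
    Set.finite_Icc (-⌊B⌋) ⌊B⌋).subset fun x hx k l => ?_
  have h := hx.1 k l
  refine ⟨?_, Int.le_floor.2 h.2⟩
  rw [neg_le]
  exact Int.le_floor.2 (by push_cast; linarith)

end

end HessianBirch

namespace HessianBirch

open MvPolynomial

/-! ### A uniform exponent in the projective Nullstellensatz -/

section Counting

variable {σ τ κ ι K : Type*}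

/-! Fix x_1, …, x_{d-2}. The equations become M x_{d-1} = 0, where M = M(x_1, …, x_{d-2}) is the
`polarMatrix` of the remaining bilinear form. Let S be the set of integers in [-B, B]. If M has rank
r, at most |S|^(n-r) vectors with entries in S lie in its kernel, so what remains is to count the
tuples with rank M ≤ r. For d = 2 the matrix M is a constant of the same rank as the Hessian, and
nothing remains.

Let d > 2. On the diagonal x_1 = … = x_{d-2} = z, the matrix M is a nonzero multiple of H_G(z)
(`rank_polarMatrix_diag`). So the cone {rank M ≤ r} meets the diagonal, which has codimension
(d-3)n, in a copy of `rankLocus G r`. If that locus has dimension m, then m further hyperplanes cut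
it down to the origin (`exists_linear_forms_rankLocus`). A cone that meets a linear space of
codimension k only in the origin has O(|S|^k) points with coordinates in S. With k = (d-3)n + m the
total exponent is k + n - r = (d-2)n + (m - r) ≤ (d-2)n + 𝓗_G.

The implied constant must not depend on G (`exists_card_le_mul_pow`). The forms f defining the cone
and the k linear forms l together generate an ideal containing a power of the irrelevant ideal; by
noetherianity its exponent can be bounded in terms of the number of variables and the number and
degrees of the forms. Hence, modulo f, every polynomial is a combination of bounded-degree monomials
with coefficients polynomial in l. Polynomials of degree O(|S|) interpolate every function on the
grid, but restricted to the cone they span only O(|S|^k) dimensions. -/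

theorem homogeneousComponent_mul_of_isHomogeneous {R : Type*} [CommSemiring R] (h : MvPolynomial σ R)
    {g : MvPolynomial σ R} {D : ℕ} (hg : g.IsHomogeneous D) (s : ℕ) :
    homogeneousComponent (s + D) (h * g) = homogeneousComponent s h * g := by
  classical
  conv_lhs => rw [← sum_homogeneousComponent h, Finset.sum_mul, map_sum]
  have key : ∀ i, homogeneousComponent (s + D) (homogeneousComponent i h * g) =
      if i = s then homogeneousComponent s h * g else 0 := by
    intro i
    rw [homogeneousComponent_of_mem
      ((homogeneousComponent_isHomogeneous i h).mul hg : _ ∈ homogeneousSubmodule σ R (i + D))]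
    by_cases his : i = s
    · simp [his]
    · rw [if_neg his, if_neg (by omega)]
  simp only [key, Finset.sum_ite_eq', Finset.mem_range]
  split_ifs with hs
  · rfl
  · rw [homogeneousComponent_eq_zero s h (by omega), zero_mul]

theorem homogeneousComponent_mul_eq_zero_of_lt {R : Type*} [CommSemiring R] (h : MvPolynomial σ R)
    {g : MvPolynomial σ R} {D : ℕ} (hg : g.IsHomogeneous D) {s : ℕ} (hs : s < D) :
    homogeneousComponent s (h * g) = 0 := by
  conv_lhs => rw [← sum_homogeneousComponent h, Finset.sum_mul, map_sum]
  refine Finset.sum_eq_zero fun i _ => ?_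
  rw [homogeneousComponent_of_mem
    ((homogeneousComponent_isHomogeneous i h).mul hg : _ ∈ homogeneousSubmodule σ R (i + D)),
    if_neg (by omega)]

theorem homogeneousComponent_mem_span_range {R : Type*} [CommRing R] [Finite τ]
    {g : τ → MvPolynomial σ R} {D : τ → ℕ} (hg : ∀ i, (g i).IsHomogeneous (D i))
    {p : MvPolynomial σ R} (hp : p ∈ Ideal.span (Set.range g)) (s : ℕ) :
    homogeneousComponent s p ∈ Ideal.span (Set.range g) := by
  have := Fintype.ofFinite τ
  obtain ⟨h, rfl⟩ := Ideal.mem_span_range_iff_exists_fun.1 hp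
  rw [map_sum]
  refine Ideal.sum_mem _ fun i _ => ?_
  rcases lt_or_ge s (D i) with hs | hs
  · rw [homogeneousComponent_mul_eq_zero_of_lt _ (hg i) hs]
    exact Ideal.zero_mem _
  · obtain ⟨s, rfl⟩ := Nat.exists_eq_add_of_le' hs
    rw [homogeneousComponent_mul_of_isHomogeneous _ (hg i)]
    exact Ideal.mul_mem_left _ _ (Ideal.subset_span ⟨i, rfl⟩)

theorem finite_degree_eq [Finite σ] (m : ℕ) : Finite {β : σ →₀ ℕ // β.degree = m} :=
  (Finsupp.finite_of_degree_le m).subset (fun _ h => le_of_eq h)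

theorem finite_degree_lt [Finite σ] (m : ℕ) : Finite {β : σ →₀ ℕ // β.degree < m} :=
  (Finsupp.finite_of_degree_le m).subset (fun _ (h : _ < m) => h.le)

/-- Containing a given power of the irrelevant ideal is an open condition on the members of an
algebraic family of homogeneous ideals. -/
theorem exists_eval_ne_zero_of_pow_idealOfVars_le [Field K] [Finite σ] [Finite τ]
    {g : τ → MvPolynomial σ (MvPolynomial ι K)} {D : τ → ℕ} (hg : ∀ i, (g i).IsHomogeneous (D i))
    {c : ι → K} {m : ℕ}
    (hc : idealOfVars σ K ^ m ≤ Ideal.span (Set.range fun i => map (eval c) (g i))) :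
    ∃ p : MvPolynomial ι K, eval c p ≠ 0 ∧ ∀ c' : ι → K, eval c' p ≠ 0 →
      idealOfVars σ K ^ m ≤ Ideal.span (Set.range fun i => map (eval c') (g i)) := by
  classical
  have := Fintype.ofFinite τ
  have := finite_degree_eq (σ := σ) m
  have := Fintype.ofFinite {β : σ →₀ ℕ // β.degree = m}
  have hmem : ∀ α : {β : σ →₀ ℕ // β.degree = m},
      ∃ h : τ → MvPolynomial σ K, ∑ i, h i * map (eval c) (g i) = monomial α.1 1 := by
    intro α
    refine Ideal.mem_span_range_iff_exists_fun.1 (hc ?_)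
    rw [monomial_mem_pow_idealOfVars_iff _ _ one_ne_zero, α.2]
  choose h hh using hmem
  -- The multipliers `h`, found at `c`, stay fixed while the parameters vary. The degree `m`
  -- coefficients are then polynomial in the parameters and form the identity matrix at `c`;
  -- wherever the determinant is nonzero, inverting the matrix recovers all monomials of degree `m`.
  let T : Matrix {β : σ →₀ ℕ // β.degree = m} {β : σ →₀ ℕ // β.degree = m} (MvPolynomial ι K) :=
    Matrix.of fun α β => coeff β.1 (∑ i, map C (h α i) * g i)
  have hT : ∀ c' : ι → K, (eval c').mapMatrix T =
      Matrix.of fun α β => coeff β.1 (∑ i, h α i * map (eval c') (g i)) := by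
    intro c'
    ext α β
    simp only [T, RingHom.mapMatrix_apply, Matrix.map_apply, Matrix.of_apply]
    rw [← coeff_map, map_sum]
    congr 1
    refine Finset.sum_congr rfl fun i _ => ?_
    rw [map_mul, map_map]
    congr 1
    have : (eval c').comp (C : K →+* MvPolynomial ι K) = RingHom.id K := by ext; simp
    rw [this, map_id]
  refine ⟨T.det, ?_, fun c' hc' => ?_⟩
  · rw [RingHom.map_det, hT]
    have : (Matrix.of fun α β : {β : σ →₀ ℕ // β.degree = m} =>
        coeff β.1 (∑ i, h α i * map (eval c) (g i))) = 1 := by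
      ext α β
      rw [Matrix.of_apply, hh, coeff_monomial, Matrix.one_apply]
      simp only [Subtype.ext_iff]
    rw [this, Matrix.det_one]
    exact one_ne_zero
  · rw [RingHom.map_det, hT] at hc'
    set T' := Matrix.of fun α β : {β : σ →₀ ℕ // β.degree = m} =>
        coeff β.1 (∑ i, h α i * map (eval c') (g i)) with hT'
    have hrow : ∀ α, ∑ β, T' α β • (monomial β.1 1 : MvPolynomial σ K) ∈
        Ideal.span (Set.range fun i => map (eval c') (g i)) := by
      intro α
      have := homogeneousComponent_mem_span_range (fun i => (hg i).map (eval c'))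
        (Ideal.mem_span_range_iff_exists_fun.2 ⟨h α, rfl⟩) m
      convert this using 1
      ext γ
      rw [coeff_homogeneousComponent, coeff_sum]
      simp only [coeff_smul, coeff_monomial, smul_eq_mul, mul_ite, mul_one, mul_zero]
      split_ifs with hγ
      · rw [Finset.sum_eq_single ⟨γ, hγ⟩]
        · simp [T']
        · intro b _ hb
          rw [if_neg fun h => hb (Subtype.ext h)]
        · simp
      · refine Finset.sum_eq_zero fun b _ => if_neg ?_
        rintro rfl
        exact hγ b.2
    rw [pow_idealOfVars_eq_span, Ideal.span_le]
    rintro _ ⟨β, hβ, rfl⟩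
    have hinv : T'⁻¹ * T' = 1 := Matrix.nonsing_inv_mul _ (isUnit_iff_ne_zero.2 hc')
    have : (monomial β 1 : MvPolynomial σ K) =
        ∑ α, C (T'⁻¹ ⟨β, hβ⟩ α) * ∑ γ, T' α γ • (monomial γ.1 1 : MvPolynomial σ K) := by
      simp only [C_mul', Finset.smul_sum, smul_smul]
      rw [Finset.sum_comm]
      simp only [← Finset.sum_smul, ← Matrix.mul_apply, hinv, Matrix.one_apply]
      simp
    change monomial β 1 ∈ _
    rw [this]
    exact Ideal.sum_mem _ fun α _ => Ideal.mul_mem_left _ _ (hrow α)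

/-- The parameters admitting some exponent form a union of open sets, each with its own exponent. By
Hilbert's basis theorem finitely many of these sets suffice, and the largest of their exponents
works throughout. -/
theorem exists_forall_pow_idealOfVars_le [Field K] [Finite σ] [Finite τ] [Finite ι]
    {g : τ → MvPolynomial σ (MvPolynomial ι K)} {D : τ → ℕ}
    (hg : ∀ i, (g i).IsHomogeneous (D i)) :
    ∃ m, ∀ c : ι → K,
      (∃ m', idealOfVars σ K ^ m' ≤ Ideal.span (Set.range fun i => map (eval c) (g i))) →
      idealOfVars σ K ^ m ≤ Ideal.span (Set.range fun i => map (eval c) (g i)) := by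
  let s : Set (MvPolynomial ι K) := {p | ∃ m, ∀ c : ι → K, eval c p ≠ 0 →
    idealOfVars σ K ^ m ≤ Ideal.span (Set.range fun i => map (eval c) (g i))}
  obtain ⟨t, hts, ht⟩ := (Submodule.fg_span_iff_fg_span_finset_subset s).1
    (IsNoetherian.noetherian (Ideal.span s))
  choose! e he using hts
  refine ⟨t.sup e, fun c hc => ?_⟩
  obtain ⟨m', hm'⟩ := hc
  obtain ⟨p, hpc, hp⟩ := exists_eval_ne_zero_of_pow_idealOfVars_le hg hm'
  have hpt : p ∈ Ideal.span (t : Set (MvPolynomial ι K)) := by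
    have : p ∈ Ideal.span s := Ideal.subset_span ⟨m', hp⟩
    rw [Ideal.span, ht] at this
    exact this
  obtain ⟨q, hqt, hq⟩ : ∃ q ∈ t, eval c q ≠ 0 := by
    by_contra! hcon
    have : Ideal.span (t : Set (MvPolynomial ι K)) ≤ RingHom.ker (eval c) :=
      Ideal.span_le.2 fun q hq => hcon q hq
    exact hpc (this hpt)
  exact (Ideal.pow_le_pow_right (Finset.le_sup hqt)).trans (he hqt c hq)

/-- The uniform exponent depends only on the number and the degrees of the forms. -/
theorem exists_forall_homogeneous_pow_idealOfVars_le (σ τ K : Type*) [Field K] [Finite σ] [Finite τ]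
    (D : τ → ℕ) :
    ∃ m, ∀ f : τ → MvPolynomial σ K, (∀ i, (f i).IsHomogeneous (D i)) →
      (∃ m', idealOfVars σ K ^ m' ≤ Ideal.span (Set.range f)) →
      idealOfVars σ K ^ m ≤ Ideal.span (Set.range f) := by
  classical
  have hfin := fun i => finite_degree_eq (σ := σ) (D i)
  have := fun i => Fintype.ofFinite {β : σ →₀ ℕ // β.degree = D i}
  -- The universal forms of degrees `D i`, with indeterminate coefficients; every family `f` is a
  -- specialization of them.
  let g : τ → MvPolynomial σ (MvPolynomial (Σ i, {β : σ →₀ ℕ // β.degree = D i}) K) := fun i =>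
    ∑ β : {β : σ →₀ ℕ // β.degree = D i}, monomial β.1 (X ⟨i, β⟩)
  have hg : ∀ i, (g i).IsHomogeneous (D i) := fun i =>
    IsHomogeneous.sum _ _ _ fun β _ => isHomogeneous_monomial _ β.2
  obtain ⟨m, hm⟩ := exists_forall_pow_idealOfVars_le hg
  refine ⟨m, fun f hf => ?_⟩
  have key : (fun i => map (eval fun b : Σ i, {β : σ →₀ ℕ // β.degree = D i} =>
      coeff b.2.1 (f b.1)) (g i)) = f := by
    funext i
    simp only [g, map_sum, map_monomial, eval_X]
    ext γ
    simp only [coeff_sum, coeff_monomial]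
    by_cases hγ : γ.degree = D i
    · rw [Finset.sum_eq_single ⟨γ, hγ⟩]
      · simp
      · intro b _ hb
        rw [if_neg fun h => hb (Subtype.ext h)]
      · simp
    · rw [(hf i).coeff_eq_zero hγ]
      refine Finset.sum_eq_zero fun b _ => if_neg ?_
      rintro rfl
      exact hγ b.2
  have := hm fun b => coeff b.2.1 (f b.1)
  rwa [key] at this

theorem exists_pow_idealOfVars_le_of_zeroLocus [Field K] [IsAlgClosed K] [Finite σ]
    {f : τ → MvPolynomial σ K} (hf : ∀ x : σ → K, (∀ i, eval x (f i) = 0) → x = 0) :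
    ∃ m, idealOfVars σ K ^ m ≤ Ideal.span (Set.range f) := by
  refine Ideal.exists_pow_le_of_le_radical_of_fg ?_ (idealOfVars_fg σ K)
  rw [← vanishingIdeal_zeroLocus_eq_radical (K := K), idealOfVars, Ideal.span_le]
  rintro _ ⟨i, rfl⟩ x hx
  have : x = 0 := hf x fun i => by
    have := hx (f i) (Ideal.subset_span ⟨i, rfl⟩)
    simpa [aeval_eq_eval] using this
  simp [this]

end Counting

/-! ### Counting grid points on a zero set -/

section Counting

variable {σ τ κ K : Type*}

/-- Products of a monomial of degree less than `m` and of powers, with exponents at most `t`, of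
the `l i`. -/
noncomputable def boundedProduct [CommSemiring K] [Fintype κ] (l : κ → MvPolynomial σ K) (m t : ℕ)
    (a : (κ → Fin (t + 1)) × {β : σ →₀ ℕ // β.degree < m}) : MvPolynomial σ K :=
  (∏ i, l i ^ (a.1 i : ℕ)) * monomial a.2.1 1

theorem boundedProduct_mem_range_succ [CommSemiring K] [Fintype κ] (l : κ → MvPolynomial σ K)
    (m t : ℕ) (a : (κ → Fin (t + 1)) × {β : σ →₀ ℕ // β.degree < m}) :
    boundedProduct l m t a ∈ Set.range (boundedProduct l m (t + 1)) :=
  ⟨(fun i => (a.1 i).castSucc, a.2), by simp [boundedProduct]⟩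

theorem mul_boundedProduct_mem_range_succ [CommSemiring K] [Fintype κ] (l : κ → MvPolynomial σ K)
    (m t : ℕ) (a : (κ → Fin (t + 1)) × {β : σ →₀ ℕ // β.degree < m}) (i : κ) :
    l i * boundedProduct l m t a ∈ Set.range (boundedProduct l m (t + 1)) := by
  classical
  refine ⟨(fun k => if k = i then (a.1 k).succ else (a.1 k).castSucc, a.2), ?_⟩
  simp only [boundedProduct, ← mul_assoc]
  congr 1
  rw [← Finset.mul_prod_erase _ _ (Finset.mem_univ i),
    ← Finset.mul_prod_erase Finset.univ (fun k => l k ^ (a.1 k : ℕ)) (Finset.mem_univ i), ← mul_assoc]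
  congr 1
  · simp [pow_succ']
  · refine Finset.prod_congr rfl fun k hk => ?_
    rw [if_neg (Finset.ne_of_mem_erase hk)]
    rfl

/-- The span of the `boundedProduct`s modulo an ideal. -/
noncomputable def boundedSpan [CommRing K] [Fintype κ] (I : Ideal (MvPolynomial σ K)) (l : κ → MvPolynomial σ K)
    (m t : ℕ) : Submodule K (MvPolynomial σ K) :=
  I.restrictScalars K ⊔ Submodule.span K (Set.range (boundedProduct l m t))

theorem boundedSpan_le_succ [CommRing K] [Fintype κ] (I : Ideal (MvPolynomial σ K))
    (l : κ → MvPolynomial σ K) (m t : ℕ) : boundedSpan I l m t ≤ boundedSpan I l m (t + 1) := by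
  refine sup_le_sup le_rfl (Submodule.span_le.2 ?_)
  rintro _ ⟨a, rfl⟩
  exact Submodule.subset_span (boundedProduct_mem_range_succ l m t a)

theorem mul_mem_boundedSpan [CommRing K] [Fintype κ] (I : Ideal (MvPolynomial σ K))
    (l : κ → MvPolynomial σ K) (m t : ℕ) (i : κ) {p : MvPolynomial σ K}
    (hp : p ∈ boundedSpan I l m t) : l i * p ∈ boundedSpan I l m (t + 1) := by
  obtain ⟨q, hq, r, hr, rfl⟩ := Submodule.mem_sup.1 hp
  rw [mul_add]
  refine add_mem (Submodule.mem_sup_left ?_) (Submodule.mem_sup_right ?_)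
  · exact I.mul_mem_left _ hq
  · have : Submodule.span K (Set.range (boundedProduct l m t)) ≤
        (Submodule.span K (Set.range (boundedProduct l m (t + 1)))).comap
          (LinearMap.mulLeft K (l i)) := by
      rw [Submodule.span_le]
      rintro _ ⟨a, rfl⟩
      exact Submodule.subset_span (mul_boundedProduct_mem_range_succ l m t a i)
    exact this hr

/-- In degree at least `m`, the form lies in the ideal generated by `f` and `l`. Taking homogeneous
components of such a representation makes the multipliers of the `l i` forms of degree one less, to
which induction applies. Each step raises the exponents of the `l i` by at most one. -/
theorem mem_boundedSpan_of_isHomogeneous [Field K] [Finite τ] [Fintype κ]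
    {f : τ → MvPolynomial σ K} {D : τ → ℕ} (hf : ∀ i, (f i).IsHomogeneous (D i))
    {l : κ → MvPolynomial σ K} (hl : ∀ i, (l i).IsHomogeneous 1) {m : ℕ}
    (hm : idealOfVars σ K ^ m ≤ Ideal.span (Set.range f) ⊔ Ideal.span (Set.range l)) (t : ℕ) :
    ∀ p : MvPolynomial σ K, p.IsHomogeneous t →
      p ∈ boundedSpan (Ideal.span (Set.range f)) l m t := by
  induction t with
  | zero =>
    intro p hp
    -- For `m = 0` there are no monomials of degree less than `m`, hence no bounded products. The
    -- degree 0 component of the relation removes the `l i` and puts `p` in the ideal of `f`.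
    rcases Nat.eq_zero_or_pos m with rfl | h0
    · have : p ∈ idealOfVars σ K ^ 0 := by simp
      obtain ⟨q, hq, r, hr, hqr⟩ := Submodule.mem_sup.1 (hm this)
      refine Submodule.mem_sup_left ?_
      obtain ⟨b, rfl⟩ := Ideal.mem_span_range_iff_exists_fun.1 hr
      have h1 := congrArg (homogeneousComponent 0) hqr
      rw [map_add, map_sum, Finset.sum_eq_zero, add_zero,
        homogeneousComponent_eq_self hp] at h1
      · rw [← h1]
        exact homogeneousComponent_mem_span_range hf hq 0
      · intro i _
        exact homogeneousComponent_mul_eq_zero_of_lt _ (hl i) one_pos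
    · refine Submodule.mem_sup_right ?_
      rw [p.as_sum]
      refine Submodule.sum_mem _ fun β hβ => ?_
      have hdeg : β.degree = 0 := hp.degree_eq_sum_deg_support hβ |>.symm
      have : monomial β (coeff β p) = coeff β p • boundedProduct l m 0 (0, ⟨β, by omega⟩) := by
        simp [boundedProduct, smul_monomial]
      rw [this]
      exact Submodule.smul_mem _ _ (Submodule.subset_span ⟨_, rfl⟩)
  | succ t ih =>
    intro p hp
    rcases lt_or_ge (t + 1) m with h0 | h0
    · refine Submodule.mem_sup_right ?_
      rw [p.as_sum]
      refine Submodule.sum_mem _ fun β hβ => ?_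
      have hdeg : β.degree = t + 1 := hp.degree_eq_sum_deg_support hβ |>.symm
      have : monomial β (coeff β p) = coeff β p • boundedProduct l m (t + 1) (0, ⟨β, by omega⟩) := by
        simp [boundedProduct, smul_monomial]
      rw [this]
      exact Submodule.smul_mem _ _ (Submodule.subset_span ⟨_, rfl⟩)
    · have : p ∈ idealOfVars σ K ^ m := by
        rw [mem_pow_idealOfVars_iff]
        intro β hβ
        have hdeg : β.degree = t + 1 := hp.degree_eq_sum_deg_support hβ |>.symm
        omega
      obtain ⟨q, hq, r, hr, hqr⟩ := Submodule.mem_sup.1 (hm this)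
      obtain ⟨b, rfl⟩ := Ideal.mem_span_range_iff_exists_fun.1 hr
      have h1 := congrArg (homogeneousComponent (t + 1)) hqr
      rw [map_add, map_sum, homogeneousComponent_eq_self hp] at h1
      rw [← h1]
      refine add_mem (Submodule.mem_sup_left (homogeneousComponent_mem_span_range hf hq _))
        (Submodule.sum_mem _ fun i _ => ?_)
      rw [homogeneousComponent_mul_of_isHomogeneous _ (hl i), mul_comm]
      exact mul_mem_boundedSpan _ _ _ _ _ (ih _ (homogeneousComponent_isHomogeneous _ _))

theorem mem_boundedSpan_of_totalDegree_le [Field K] [Finite τ] [Fintype κ]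
    {f : τ → MvPolynomial σ K} {D : τ → ℕ} (hf : ∀ i, (f i).IsHomogeneous (D i))
    {l : κ → MvPolynomial σ K} (hl : ∀ i, (l i).IsHomogeneous 1) {m : ℕ}
    (hm : idealOfVars σ K ^ m ≤ Ideal.span (Set.range f) ⊔ Ideal.span (Set.range l)) {t : ℕ}
    {p : MvPolynomial σ K} (hp : p.totalDegree ≤ t) :
    p ∈ boundedSpan (Ideal.span (Set.range f)) l m t := by
  rw [← sum_homogeneousComponent p]
  refine Submodule.sum_mem _ fun i hi => ?_
  exact monotone_nat_of_le_succ (boundedSpan_le_succ (Ideal.span (Set.range f)) l m)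
    ((Finset.mem_range_succ_iff.1 hi).trans hp)
    (mem_boundedSpan_of_isHomogeneous hf hl hm i _ (homogeneousComponent_isHomogeneous _ _))

/-- Functions on a subset of a grid are polynomials of bounded degree. -/
theorem exists_interpolation [Field K] [Fintype σ] (S : Finset K) (x : σ → K) :
    ∃ p : MvPolynomial σ K, p.totalDegree ≤ Fintype.card σ * S.card ∧ eval x p ≠ 0 ∧
      ∀ y : σ → K, (∀ i, y i ∈ S) → y ≠ x → eval y p = 0 := by
  classical
  refine ⟨∏ i, ∏ s ∈ S.erase (x i), (X i - C s), ?_, ?_, ?_⟩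
  · refine (totalDegree_finsetProd _ _).trans ?_
    rw [← smul_eq_mul, ← Finset.card_univ]
    refine Finset.sum_le_card_nsmul _ _ _ fun i _ => ?_
    refine (totalDegree_finsetProd _ _).trans ?_
    refine (Finset.sum_le_card_nsmul _ _ 1 fun s _ => ?_).trans ?_
    · refine (totalDegree_sub _ _).trans ?_
      simp
    · simpa using Finset.card_le_card (Finset.erase_subset (x i) S)
  · simp only [map_prod, map_sub, eval_X, eval_C]
    refine Finset.prod_ne_zero_iff.2 fun i _ => Finset.prod_ne_zero_iff.2 fun s hs => ?_
    exact sub_ne_zero.2 (Finset.ne_of_mem_erase hs).symm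
  · intro y hy hyx
    obtain ⟨i, hi⟩ := Function.ne_iff.1 hyx
    simp only [map_prod, map_sub, eval_X, eval_C]
    refine Finset.prod_eq_zero (Finset.mem_univ i) ?_
    exact Finset.prod_eq_zero (Finset.mem_erase.2 ⟨hi, hy i⟩) (sub_self _)

/-- The space of functions on `Y` has dimension `Y.card`. It is spanned by restrictions of
polynomials of degree at most `t = Fintype.card σ * S.card`, hence by the bounded products, since
the ideal of `f` vanishes on `Y`. The bound is the number of bounded products. -/
theorem card_le_of_pow_idealOfVars_le [Field K] [Fintype σ] [Finite τ] [Fintype κ]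
    {f : τ → MvPolynomial σ K} {D : τ → ℕ} (hf : ∀ i, (f i).IsHomogeneous (D i))
    {l : κ → MvPolynomial σ K} (hl : ∀ i, (l i).IsHomogeneous 1) {m : ℕ}
    (hm : idealOfVars σ K ^ m ≤ Ideal.span (Set.range f) ⊔ Ideal.span (Set.range l))
    (S : Finset K) (Y : Finset (σ → K)) (hYS : ∀ x ∈ Y, ∀ i, x i ∈ S)
    (hYf : ∀ x ∈ Y, ∀ i, eval x (f i) = 0) :
    Y.card ≤ (Fintype.card σ * S.card + 1) ^ Fintype.card κ *
      Nat.card {β : σ →₀ ℕ // β.degree < m} := by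
  classical
  have := finite_degree_lt (σ := σ) m
  have := Fintype.ofFinite {β : σ →₀ ℕ // β.degree < m}
  set t := Fintype.card σ * S.card
  let ev : MvPolynomial σ K →ₗ[K] (Y → K) := LinearMap.pi fun y => (aeval y.1).toLinearMap
  have hev : ∀ p y, ev p y = eval y.1 p := fun p y => by simp [ev, aeval_eq_eval]
  have hspan : ∀ p ∈ boundedSpan (Ideal.span (Set.range f)) l m t,
      ev p ∈ Submodule.span K (Set.range (ev ∘ boundedProduct l m t)) := by
    intro p hp
    obtain ⟨q, hq, r, hr, rfl⟩ := Submodule.mem_sup.1 hp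
    have hq0 : ev q = 0 := by
      funext y
      rw [hev]
      have : Ideal.span (Set.range f) ≤ RingHom.ker (eval y.1) := by
        rw [Ideal.span_le]
        rintro _ ⟨i, rfl⟩
        exact hYf y.1 y.2 i
      exact this hq
    rw [map_add, hq0, zero_add, Set.range_comp, Submodule.span_image]
    exact Submodule.mem_map_of_mem hr
  have htop : Submodule.span K (Set.range (ev ∘ boundedProduct l m t)) = ⊤ := by
    rw [eq_top_iff, ← (Pi.basisFun K Y).span_eq, Submodule.span_le]
    rintro _ ⟨y, rfl⟩
    obtain ⟨p, hpd, hpy, hp⟩ := exists_interpolation S y.1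
    have h1 := hspan p (mem_boundedSpan_of_totalDegree_le hf hl hm hpd)
    have h2 : (Pi.basisFun K Y) y = (eval y.1 p)⁻¹ • ev p := by
      funext z
      rw [Pi.smul_apply, hev, Pi.basisFun_apply, Pi.single_apply, smul_eq_mul]
      split_ifs with hzy
      · rw [hzy, inv_mul_cancel₀ hpy]
      · rw [hp z.1 (hYS z.1 z.2) fun h => hzy (Subtype.ext h), mul_zero]
    rw [h2]
    exact Submodule.smul_mem _ _ h1
  have hcard := finrank_range_le_card (R := K) (ev ∘ boundedProduct l m t)
  rw [Set.finrank, htop, finrank_top, Module.finrank_fintype_fun_eq_card] at hcard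
  simpa [Nat.card_eq_fintype_card] using hcard

/-- The number of points of a grid on the zero set of forms of given degrees is at most a constant
times the `k`-th power of the side of the grid if the zero set meets a linear subspace of
codimension at most `k` only in the origin. The constant does not depend on the forms. -/
theorem exists_card_le_mul_pow (σ τ κ K : Type*) [Field K] [IsAlgClosed K] [Fintype σ] [Finite τ]
    [Fintype κ] (D : τ → ℕ) :
    ∃ C : ℕ, ∀ (f : τ → MvPolynomial σ K) (l : κ → MvPolynomial σ K),
      (∀ i, (f i).IsHomogeneous (D i)) → (∀ i, (l i).IsHomogeneous 1) →
      (∀ x : σ → K, (∀ i, eval x (f i) = 0) → (∀ i, eval x (l i) = 0) → x = 0) →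
      ∀ (S : Finset K) (Y : Finset (σ → K)), S.Nonempty → (∀ x ∈ Y, ∀ i, x i ∈ S) →
        (∀ x ∈ Y, ∀ i, eval x (f i) = 0) → Y.card ≤ C * S.card ^ Fintype.card κ := by
  obtain ⟨m, hm⟩ := exists_forall_homogeneous_pow_idealOfVars_le σ (τ ⊕ κ) K
    (Sum.elim D fun _ => 1)
  refine ⟨(Fintype.card σ + 1) ^ Fintype.card κ * Nat.card {β : σ →₀ ℕ // β.degree < m},
    fun f l hf hl h0 S Y hS hYS hYf => ?_⟩
  have h1 := hm (Sum.elim f l) (by rintro (i | i); exacts [hf i, hl i])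
    (exists_pow_idealOfVars_le_of_zeroLocus fun x hx =>
      h0 x (fun i => hx (Sum.inl i)) fun i => hx (Sum.inr i))
  rw [Set.Sum.elim_range, Ideal.span_union] at h1
  refine (card_le_of_pow_idealOfVars_le hf hl h1 S Y hYS hYf).trans ?_
  rw [mul_right_comm, ← mul_pow]
  refine Nat.mul_le_mul_right _ (Nat.pow_le_pow_left ?_ _)
  have := hS.card_pos
  nlinarith

end Counting

/-! ### Cutting a cone down to the origin by hyperplanes -/

section LinearSections

variable {σ K : Type*}

theorem isMaximal_of_forall_X_mem [Field K] {P : Ideal (MvPolynomial σ K)} (hP : P ≠ ⊤)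
    (h : ∀ i, X i ∈ P) : P.IsMaximal := by
  have hmax : (RingHom.ker (aeval (R := K) (0 : σ → K))).IsMaximal :=
    RingHom.ker_isMaximal_of_surjective _ fun z => ⟨C z, by simp⟩
  have hle : RingHom.ker (aeval (R := K) (0 : σ → K)) ≤ P := by
    intro p hp
    have h0 : coeff 0 p = 0 := by
      rw [RingHom.mem_ker, aeval_zero] at hp
      simpa [constantCoeff_eq] using hp
    have : p ∈ idealOfVars σ K ^ 1 := by
      rw [mem_pow_idealOfVars_iff']
      intro x hx
      rw [(Finsupp.degree_eq_zero_iff x).1 (by omega), h0]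
    rw [pow_one] at this
    refine Ideal.span_le.2 ?_ this
    rintro _ ⟨i, rfl⟩
    exact h i
  rwa [← hmax.eq_of_le hP hle]

/-- The linear forms in a given `P` are a proper subspace, and a vector space over an infinite field
is not a finite union of proper subspaces. -/
theorem exists_linear_notMem [Field K] [Infinite K] [Fintype σ]
    {s : Set (Ideal (MvPolynomial σ K))} (hs : s.Finite) (h : ∀ P ∈ s, ∃ i, X i ∉ P) :
    ∃ l : MvPolynomial σ K, l.IsHomogeneous 1 ∧ ∀ P ∈ s, l ∉ P := by
  classical
  let φ : (σ → K) →ₗ[K] MvPolynomial σ K := Fintype.linearCombination K X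
  let V : Ideal (MvPolynomial σ K) → Subspace K (σ → K) := fun P => (P.restrictScalars K).comap φ
  have htop : ⊤ ∉ hs.toFinset.image V := by
    intro hV
    obtain ⟨P, hP, hPV⟩ := Finset.mem_image.1 hV
    obtain ⟨i, hi⟩ := h P (hs.mem_toFinset.1 hP)
    have : Pi.single i 1 ∈ V P := by rw [hPV]; trivial
    refine hi ?_
    simpa [V, φ, Fintype.linearCombination_apply_single] using this
  have hne := Subspace.biUnion_ne_univ_of_top_notMem htop
  obtain ⟨a, ha⟩ := (Set.ne_univ_iff_exists_notMem _).1 hne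
  refine ⟨φ a, ?_, fun P hP haP => ha ?_⟩
  · rw [Fintype.linearCombination_apply]
    refine IsHomogeneous.sum _ _ _ fun i _ => ?_
    rw [smul_eq_C_mul]
    exact isHomogeneous_C_mul_X _ _
  · simp only [Set.mem_iUnion]
    exact ⟨V P, Finset.mem_image_of_mem V (hs.mem_toFinset.2 hP), haP⟩

/-- Take `l` outside every minimal prime of `I` that does not contain all variables. A chain of
primes above `I` and `l` can then be extended downwards by a minimal prime of `I`, unless that prime
is the irrelevant ideal. In the exceptional case the prime is maximal and the chain has length 0. -/
theorem exists_linear_ringKrullDim_quotient_sup_le [Field K] [Infinite K] [Fintype σ]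
    (I : Ideal (MvPolynomial σ K)) {m : ℕ}
    (h : ringKrullDim (MvPolynomial σ K ⧸ I) ≤ ((m + 1 : ℕ) : WithBot ℕ∞)) :
    ∃ l : MvPolynomial σ K, l.IsHomogeneous 1 ∧
      ringKrullDim (MvPolynomial σ K ⧸ (I ⊔ Ideal.span {l})) ≤ (m : WithBot ℕ∞) := by
  obtain ⟨l, hl, hlP⟩ := exists_linear_notMem (σ := σ) (K := K)
    (s := {P ∈ I.minimalPrimes | ∃ i, X i ∉ P})
    (I.finite_minimalPrimes_of_isNoetherianRing.subset fun P hP => hP.1) fun P hP => hP.2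
  refine ⟨l, hl, ?_⟩
  rw [ringKrullDim_quotient] at h ⊢
  refine iSup_le fun c => ?_
  have hsub : ∀ q : PrimeSpectrum.zeroLocus (R := MvPolynomial σ K) ↑(I ⊔ Ideal.span {l}),
      q.1 ∈ PrimeSpectrum.zeroLocus (I : Set (MvPolynomial σ K)) := fun q =>
    (le_sup_left : I ≤ I ⊔ Ideal.span {l}).trans q.2
  obtain ⟨P, hP, hPc⟩ := Ideal.exists_minimalPrimes_le (J := c.head.1.asIdeal) (hsub c.head)
  by_cases hX : ∃ i, X i ∉ P
  · let P' : PrimeSpectrum.zeroLocus (I : Set (MvPolynomial σ K)) := ⟨⟨P, hP.1.1⟩, hP.1.2⟩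
    let c' : LTSeries (PrimeSpectrum.zeroLocus (I : Set (MvPolynomial σ K))) :=
      c.map (fun q => ⟨q.1, hsub q⟩) fun _ _ h => h
    have hlt : P' < c'.head := by
      refine lt_of_le_of_ne hPc fun heq => hlP P ⟨hP, hX⟩ ?_
      have : P = c.head.1.asIdeal := congrArg (fun q => q.1.asIdeal) heq
      rw [this]
      exact c.head.2 (Ideal.mem_sup_right (Ideal.mem_span_singleton_self l))
    have := (le_iSup (fun s : LTSeries _ => (s.length : WithBot ℕ∞)) (c'.cons P' hlt)).trans h
    have h2 : c.length + 1 ≤ m + 1 := by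
      have h3 : (c'.cons P' hlt).length = c.length + 1 := by
        rw [RelSeries.cons_length]
        rfl
      rw [← h3]
      exact_mod_cast this
    exact_mod_cast Nat.le_of_succ_le_succ h2
  · push Not at hX
    have hmax := isMaximal_of_forall_X_mem hP.1.1.ne_top hX
    have hlen : c.length = 0 := by
      by_contra h0
      have hlt : c.head < c.last := by
        rw [← RelSeries.apply_zero, ← RelSeries.apply_last]
        exact c.strictMono (by rw [Fin.lt_def]; simp; omega)
      have hhead := hmax.eq_of_le c.head.1.2.ne_top hPc
      have hlast := hmax.eq_of_le c.last.1.2.ne_top (hPc.trans hlt.le)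
      exact hlt.ne (Subtype.ext (PrimeSpectrum.ext (hhead.symm.trans hlast)))
    rw [hlen]
    exact_mod_cast Nat.zero_le m

theorem exists_linear_forms_ringKrullDim_le_zero [Field K] [Infinite K] [Fintype σ] (m : ℕ) :
    ∀ I : Ideal (MvPolynomial σ K), ringKrullDim (MvPolynomial σ K ⧸ I) ≤ (m : WithBot ℕ∞) →
      ∃ l : Fin m → MvPolynomial σ K, (∀ i, (l i).IsHomogeneous 1) ∧
        ringKrullDim (MvPolynomial σ K ⧸ (I ⊔ Ideal.span (Set.range l))) ≤ 0 := by
  induction m with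
  | zero =>
    intro I hI
    refine ⟨Fin.elim0, fun i => i.elim0, ?_⟩
    rw [Set.range_eq_empty, Ideal.span_empty, sup_bot_eq]
    exact hI
  | succ m ih =>
    intro I hI
    obtain ⟨l₀, hl₀, hdim⟩ := exists_linear_ringKrullDim_quotient_sup_le I hI
    obtain ⟨l, hl, hdim'⟩ := ih _ hdim
    refine ⟨Fin.cons l₀ l, Fin.cases hl₀ hl, ?_⟩
    rwa [Fin.range_cons, Set.insert_eq, Ideal.span_union, ← sup_assoc]

/-- A cone that meets a subspace in dimension at most `0` meets it only in the origin. -/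
theorem eq_zero_of_ringKrullDim_le_zero [Field K] [Infinite K] {I : Ideal (MvPolynomial σ K)}
    (h : ringKrullDim (MvPolynomial σ K ⧸ I) ≤ 0) {x : σ → K}
    (hx : ∀ t : K, ∀ p ∈ I, eval (t • x) p = 0) : x = 0 := by
  by_contra hx0
  -- Restriction to the line through `x`. For `x ≠ 0` its kernel, the ideal of the line, lies
  -- strictly inside the ideal of the point `x`, which gives a chain of length 1.
  let φ : MvPolynomial σ K →ₐ[K] Polynomial K := aeval fun i => Polynomial.C (x i) * Polynomial.X
  have hφ : ∀ (t : K) p, (φ p).eval t = eval (t • x) p := by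
    intro t p
    have : (Polynomial.aeval t).comp φ = aeval (t • x) := by
      ext i
      simp only [φ, AlgHom.comp_apply, aeval_X, map_mul, Polynomial.aeval_C, Polynomial.aeval_X,
        Algebra.algebraMap_self, RingHom.id_apply, Pi.smul_apply, smul_eq_mul]
      rw [mul_comm]
    have h2 := DFunLike.congr_fun this p
    simpa [aeval_eq_eval, Polynomial.aeval_def] using h2
  have hprime : (RingHom.ker φ).IsPrime := RingHom.ker_isPrime φ
  have hprime' : (RingHom.ker (eval x)).IsPrime := RingHom.ker_isPrime _
  have hI : I ≤ RingHom.ker φ := fun p hp =>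
    Polynomial.funext fun t => by rw [hφ, hx t p hp, Polynomial.eval_zero]
  have hle : RingHom.ker φ ≤ RingHom.ker (eval x) := fun p hp => by
    have h1 := hφ 1 p
    rw [(RingHom.mem_ker).1 hp, Polynomial.eval_zero, one_smul] at h1
    exact h1.symm
  have hlt : RingHom.ker φ < RingHom.ker (eval x) := by
    refine lt_of_le_of_ne hle fun heq => ?_
    obtain ⟨i, hi⟩ := Function.ne_iff.1 hx0
    have h1 : (X i - C (x i) : MvPolynomial σ K) ∈ RingHom.ker (eval x) := by simp
    rw [← heq, RingHom.mem_ker] at h1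
    have h2 := hφ 0 (X i - C (x i))
    rw [h1] at h2
    simp at h2
    exact hi h2
  rw [ringKrullDim_quotient] at h
  let a : PrimeSpectrum.zeroLocus (I : Set (MvPolynomial σ K)) := ⟨⟨_, hprime⟩, hI⟩
  let b : PrimeSpectrum.zeroLocus (I : Set (MvPolynomial σ K)) := ⟨⟨_, hprime'⟩, hI.trans hle⟩
  have hab : a < b := hlt
  let b₀ : LTSeries (PrimeSpectrum.zeroLocus (I : Set (MvPolynomial σ K))) :=
    RelSeries.singleton _ b
  have := (le_iSup (fun s : LTSeries _ => (s.length : WithBot ℕ∞))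
    (b₀.cons a hab)).trans h
  have h0 : (b₀.cons a hab).length ≤ 0 := by exact_mod_cast this
  have h1 : (b₀.cons a hab).length = 1 := rfl
  omega

end LinearSections

/-! ### Rank, minors and kernels over a grid -/

section Matrices

variable {m n K : Type*} [Field K] [Fintype n]

theorem exists_linearIndependent_col_submatrix [Finite m] (A : Matrix m n K) {k : ℕ}
    (hk : k ≤ A.rank) : ∃ s : Fin k → n, LinearIndependent K (A.submatrix id s).col := by
  rw [Matrix.rank_eq_finrank_span_cols] at hk
  obtain ⟨f, hf, -, hli⟩ := Submodule.exists_fun_fin_finrank_span_eq K (Set.range A.col)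
  choose s hs using hf
  refine ⟨s ∘ Fin.castLE hk, ?_⟩
  have : (A.submatrix id (s ∘ Fin.castLE hk)).col = f ∘ Fin.castLE hk := by
    funext i
    rw [Function.comp_apply, ← hs]
    rfl
  rw [this]
  exact hli.comp _ (Fin.castLE_injective hk)

theorem det_ne_zero_of_linearIndependent_col {k : Type*} [Fintype k] [DecidableEq k]
    {A : Matrix k k K} (h : LinearIndependent K A.col) : A.det ≠ 0 := by
  rw [Matrix.linearIndependent_cols_iff_isUnit, Matrix.isUnit_iff_isUnit_det] at h
  exact h.ne_zero

theorem exists_det_submatrix_ne_zero [Fintype m] (A : Matrix m n K) {k : ℕ} (hk : k ≤ A.rank) :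
    ∃ (s : Fin k → m) (t : Fin k → n), (A.submatrix s t).det ≠ 0 := by
  obtain ⟨t, ht⟩ := exists_linearIndependent_col_submatrix A hk
  have hrank : k ≤ (A.submatrix id t).transpose.rank := by
    have : (A.submatrix id t).transpose.rank = k := by
      simpa using LinearIndependent.rank_matrix (M := (A.submatrix id t).transpose) ht
    exact this.ge
  obtain ⟨s, hs⟩ := exists_linearIndependent_col_submatrix _ hrank
  refine ⟨s, t, ?_⟩
  rw [← Matrix.det_transpose]
  exact det_ne_zero_of_linearIndependent_col hs

theorem rank_le_iff_forall_det_submatrix_eq_zero [Fintype m] (A : Matrix m n K) (r : ℕ) :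
    A.rank ≤ r ↔ ∀ (s : Fin (r + 1) → m) (t : Fin (r + 1) → n), (A.submatrix s t).det = 0 := by
  constructor
  · intro h s t
    by_contra hdet
    have h1 := Matrix.rank_of_det_ne_zero hdet
    have h2 := A.rank_submatrix_le s t
    rw [Fintype.card_fin] at h1
    omega
  · intro h
    by_contra! hr
    obtain ⟨s, t, hst⟩ := exists_det_submatrix_ne_zero A hr
    exact hst (h s t)

/-- A nonvanishing maximal minor of a basis matrix of `W` singles out `finrank K W` coordinates that
determine a vector of `W`, and each of them takes values in `S`. -/
theorem card_filter_mem_submodule_le [DecidableEq n] (W : Submodule K (n → K))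
    [DecidablePred (· ∈ W)] (S : Finset K) :
    ((Fintype.piFinset fun _ : n => S).filter (· ∈ W)).card ≤ S.card ^ Module.finrank K W := by
  classical
  let b := Module.finBasis K W
  let A : Matrix (Fin (Module.finrank K W)) n K := Matrix.of fun i => (b i : n → K)
  have hA : LinearIndependent K A.row :=
    b.linearIndependent.map' W.subtype (Submodule.ker_subtype W)
  obtain ⟨t, ht⟩ := exists_linearIndependent_col_submatrix (k := Module.finrank K W) A
    (by simpa using hA.rank_matrix.ge)
  have hdet := det_ne_zero_of_linearIndependent_col ht
  have hinj : ∀ w ∈ W, (∀ i, w (t i) = 0) → w = 0 := by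
    intro w hw h0
    have hsum : Matrix.vecMul (b.repr ⟨w, hw⟩) A = w := by
      have h1 := congrArg Subtype.val (b.sum_repr ⟨w, hw⟩)
      rw [AddSubmonoidClass.coe_finsetSum] at h1
      funext j
      have h2 := congrFun h1 j
      simpa [Matrix.vecMul, dotProduct, A, Finset.sum_apply] using h2
    have hc : (b.repr ⟨w, hw⟩ : Fin _ → K) = 0 := by
      by_contra hne
      refine hdet (Matrix.exists_vecMul_eq_zero_iff.1 ⟨_, hne, ?_⟩)
      funext i
      have := congrFun hsum (t i)
      rw [h0 i] at this
      exact this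
    rw [← hsum, hc, Matrix.zero_vecMul]
  have hcard : (Fintype.piFinset fun _ : Fin (Module.finrank K W) => S).card =
      S.card ^ Module.finrank K W := by simp
  rw [← hcard]
  refine Finset.card_le_card_of_injOn (fun y i => y (t i)) ?_ ?_
  · intro y hy
    have := Fintype.mem_piFinset.1 (Finset.mem_filter.1 hy).1
    exact Fintype.mem_piFinset.2 fun i => this (t i)
  · intro y hy z hz hyz
    have hy' := (Finset.mem_filter.1 hy).2
    have hz' := (Finset.mem_filter.1 hz).2
    refine sub_eq_zero.1 (hinj _ (W.sub_mem hy' hz') fun i => ?_)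
    exact sub_eq_zero.2 (congrFun hyz i)

theorem card_filter_mulVec_eq_zero_le [Fintype m] [DecidableEq n] [DecidableEq K]
    (A : Matrix m n K) (S : Finset K) :
    ((Fintype.piFinset fun _ : n => S).filter fun y => A.mulVec y = 0).card ≤
      S.card ^ (Fintype.card n - A.rank) := by
  classical
  have hker : Module.finrank K (LinearMap.ker A.mulVecLin) = Fintype.card n - A.rank := by
    have := A.mulVecLin.finrank_range_add_finrank_ker
    rw [Module.finrank_fintype_fun_eq_card] at this
    rw [Matrix.rank]
    omega
  rw [← hker]
  refine le_trans (le_of_eq ?_) (card_filter_mem_submodule_le (LinearMap.ker A.mulVecLin) S)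
  refine congrArg _ (Finset.filter_congr fun y _ => ?_)
  simp

end Matrices

/-! ### Symmetry and Leibniz rule for the polar form -/

section Polarization

variable {n d : ℕ} {K L : Type*} [CommRing K] [Algebra ℚ K] [CommRing L] [Algebra ℚ L]

theorem map_polarForm (G : MvPolynomial (Fin n) ℤ) (φ : K →+* L) (x : Fin d → Fin n → K) :
    φ (polarForm G d x) = polarForm G d fun k i => φ (x k i) := by
  have h : ∀ q : ℚ, φ (algebraMap ℚ K q) = algebraMap ℚ L q := fun q =>
    DFunLike.congr_fun (Subsingleton.elim (φ.comp (algebraMap ℚ K)) (algebraMap ℚ L)) q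
  simp only [polarForm, map_mul, map_natCast, map_sum, map_prod, h]

theorem polarForm_comp_perm (G : MvPolynomial (Fin n) ℤ) (x : Fin d → Fin n → K)
    (s : Equiv.Perm (Fin d)) : polarForm G d (x ∘ s) = polarForm G d x := by
  simp only [polarForm]
  congr 1
  refine Fintype.sum_equiv (Equiv.arrowCongr s (Equiv.refl _)) _ _ fun j => ?_
  have hj : (Equiv.arrowCongr s (Equiv.refl (Fin n))) j = j ∘ s.symm := rfl
  rw [hj, symCoeff_comp_perm]
  congr 1
  rw [← Equiv.prod_comp s fun k => x k ((j ∘ s.symm) k)]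
  simp

theorem polarForm_update (G : MvPolynomial (Fin n) ℤ) (x : Fin d → Fin n → K) (k : Fin d)
    (v : Fin n → K) : polarForm G d (Function.update x k v) = (d.factorial : K) *
      ∑ j : Fin d → Fin n, algebraMap ℚ K (symCoeff G d j) *
        ((∏ k' ∈ Finset.univ.erase k, x k' (j k')) * v (j k)) := by
  simp only [polarForm]
  congr 1
  refine Finset.sum_congr rfl fun j _ => ?_
  rw [← Finset.prod_erase_mul _ _ (Finset.mem_univ k), Function.update_self]
  congr 2
  refine Finset.prod_congr rfl fun k' hk' => ?_
  rw [Function.update_of_ne (Finset.ne_of_mem_erase hk')]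

theorem derivation_prod {ι : Type*} [DecidableEq ι] (D : Derivation ℚ K K) (s : Finset ι)
    (f : ι → K) : D (∏ i ∈ s, f i) = ∑ i ∈ s, (∏ k ∈ s.erase i, f k) * D (f i) := by
  induction s using Finset.induction_on with
  | empty => simp
  | insert a s ha ih =>
    rw [Finset.prod_insert ha, D.leibniz, ih, Finset.sum_insert ha, Finset.erase_insert ha,
      smul_eq_mul, smul_eq_mul, add_comm, Finset.mul_sum]
    congr 1
    refine Finset.sum_congr rfl fun i hi => ?_
    have hne : a ≠ i := fun h => ha (h ▸ hi)
    rw [Finset.erase_insert_of_ne hne, Finset.prod_insert fun h => ha (Finset.mem_of_mem_erase h),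
      mul_assoc]

theorem derivation_polarForm (G : MvPolynomial (Fin n) ℤ) (D : Derivation ℚ K K)
    (x : Fin d → Fin n → K) :
    D (polarForm G d x) = ∑ k, polarForm G d (Function.update x k fun i => D (x k i)) := by
  simp only [polarForm_update]
  rw [← Finset.mul_sum, Finset.sum_comm, polarForm, ← nsmul_eq_mul, map_nsmul, nsmul_eq_mul,
    map_sum]
  congr 1
  refine Finset.sum_congr rfl fun j _ => ?_
  rw [← Finset.mul_sum, ← Algebra.smul_def, D.map_smul, derivation_prod, Algebra.smul_def]

theorem exists_perm_apply_eq {α : Type*} [DecidableEq α] {p q k l : α} (hpq : p ≠ q)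
    (hkl : k ≠ l) : ∃ s : Equiv.Perm α, s p = k ∧ s q = l := by
  have hne : Equiv.swap p k q ≠ k := fun h =>
    hpq ((Equiv.swap p k).injective (h.trans (Equiv.swap_apply_left p k).symm)).symm
  refine ⟨(Equiv.swap p k).trans (Equiv.swap (Equiv.swap p k q) l), ?_, ?_⟩
  · rw [Equiv.trans_apply, Equiv.swap_apply_left, Equiv.swap_apply_of_ne_of_ne hne.symm hkl]
  · rw [Equiv.trans_apply, Equiv.swap_apply_left]

end Polarization

/-! ### The polar matrix and the Hessian -/

section PolarMatrix

variable {n e : ℕ} {K L : Type*} [CommRing K] [Algebra ℚ K] [CommRing L] [Algebra ℚ L]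

/-- The matrix of the bilinear form that is obtained from the polar form of a form of degree
`e + 2` by fixing the first `e` arguments. -/
noncomputable def polarMatrix (G : MvPolynomial (Fin n) ℤ) (x : Fin e → Fin n → K) :
    Matrix (Fin n) (Fin n) K :=
  Matrix.of fun a b => polarForm G (e + 2)
    (Fin.snoc (α := fun _ => Fin n → K) (Fin.snoc (α := fun _ => Fin n → K) x (Pi.single b 1))
      (Pi.single a 1))

theorem polarForm_snoc_snoc (G : MvPolynomial (Fin n) ℤ) (x : Fin e → Fin n → K)
    (y z : Fin n → K) :
    polarForm G (e + 2) (Fin.snoc (α := fun _ => Fin n → K)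
      (Fin.snoc (α := fun _ => Fin n → K) x y) z) =
      ((e + 2).factorial : K) * ∑ j : Fin (e + 2) → Fin n, algebraMap ℚ K (symCoeff G (e + 2) j) *
        ((∏ k : Fin e, x k (j k.castSucc.castSucc)) * y (j (Fin.last e).castSucc) *
          z (j (Fin.last (e + 1)))) := by
  simp only [polarForm, Fin.prod_univ_castSucc, Fin.snoc_castSucc, Fin.snoc_last]

theorem polarMatrix_mulVec (G : MvPolynomial (Fin n) ℤ) (x : Fin e → Fin n → K) (y : Fin n → K)
    (a : Fin n) : (polarMatrix G x).mulVec y a = polarForm G (e + 2)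
      (Fin.snoc (α := fun _ => Fin n → K) (Fin.snoc (α := fun _ => Fin n → K) x y)
        (Pi.single a 1)) := by
  simp only [Matrix.mulVec, dotProduct, polarMatrix, Matrix.of_apply, polarForm_snoc_snoc,
    mul_assoc, Finset.sum_mul, ← Finset.mul_sum]
  rw [Finset.sum_comm]
  congr 1
  refine Finset.sum_congr rfl fun j _ => ?_
  rw [Finset.sum_eq_single (j (Fin.last e).castSucc)]
  · simp only [Pi.single_eq_same]
    ring
  · intro b _ hb
    simp [Pi.single_eq_of_ne hb.symm]
  · simp

theorem map_polarMatrix (G : MvPolynomial (Fin n) ℤ) (φ : K →+* L) (x : Fin e → Fin n → K) :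
    (polarMatrix G x).map φ = polarMatrix G fun k i => φ (x k i) := by
  ext a b
  simp only [polarMatrix, Matrix.map_apply, Matrix.of_apply, map_polarForm]
  congr 1
  funext k i
  refine Fin.lastCases ?_ (fun k => Fin.lastCases ?_ (fun k => ?_) k) k
  · simp [Pi.single_apply, apply_ite φ]
  · simp [Pi.single_apply, apply_ite φ]
  · simp

theorem isHomogeneous_polarMatrix (G : MvPolynomial (Fin n) ℤ) (a b : Fin n) :
    (polarMatrix (K := MvPolynomial (Fin e × Fin n) ℂ) G (fun k i => X (k, i)) a b).IsHomogeneous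
      e := by
  have hC : ∀ q : ℚ, (algebraMap ℚ (MvPolynomial (Fin e × Fin n) ℂ) q).IsHomogeneous 0 := fun q => by
    rw [IsScalarTower.algebraMap_apply ℚ ℂ]
    exact isHomogeneous_C _ _
  have hs : ∀ a i : Fin n,
      ((Pi.single a 1 : Fin n → MvPolynomial (Fin e × Fin n) ℂ) i).IsHomogeneous 0 := fun a i => by
    rw [Pi.single_apply]
    split_ifs
    exacts [isHomogeneous_one _ _, isHomogeneous_zero _ _ _]
  have hN : (((e + 2).factorial : ℕ) : MvPolynomial (Fin e × Fin n) ℂ).IsHomogeneous 0 := by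
    rw [← map_natCast C]
    exact isHomogeneous_C _ _
  have hmul : ∀ {p q : MvPolynomial (Fin e × Fin n) ℂ}, p.IsHomogeneous 0 → q.IsHomogeneous e →
      (p * q).IsHomogeneous e := fun hp hq => by simpa using hp.mul hq
  rw [polarMatrix, Matrix.of_apply, polarForm_snoc_snoc]
  refine hmul hN (IsHomogeneous.sum _ _ _ fun j _ => hmul (hC _) ?_)
  refine IsHomogeneous.mul (m := e) (n := 0) (IsHomogeneous.mul (m := e) (n := 0) ?_ (hs _ _))
    (hs _ _)
  have := IsHomogeneous.prod (Finset.univ : Finset (Fin e))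
    (fun k => (X (k, j k.castSucc.castSucc) : MvPolynomial (Fin e × Fin n) ℂ)) (fun _ => 1)
    fun k _ => isHomogeneous_X _ _
  simpa using this

theorem polarForm_X {d : ℕ} (G : MvPolynomial (Fin n) ℤ) (hG : G.IsHomogeneous d) :
    polarForm G d (fun _ i => (X i : MvPolynomial (Fin n) ℚ)) =
      (d.factorial : MvPolynomial (Fin n) ℚ) * map (Int.castRingHom ℚ) G := by
  rw [polarForm, ← sum_symCoeff G hG]
  rfl

/-- By the Leibniz rule the two derivatives hit an ordered pair of slots. A repeated slot gives 0,
because the first derivative leaves a constant vector there. Each of the `(e + 2) * (e + 1)` pairs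
of distinct slots gives the same entry of the polar matrix, by symmetry. -/
theorem pderiv_pderiv_polarForm_X (G : MvPolynomial (Fin n) ℤ) (a b : Fin n) :
    pderiv a (pderiv b (polarForm G (e + 2) fun _ i => (X i : MvPolynomial (Fin n) ℚ))) =
      ((e + 2) * (e + 1) : ℕ) • polarMatrix (e := e) G (fun _ i => X i) a b := by
  classical
  set P := polarMatrix (e := e) (K := MvPolynomial (Fin n) ℚ) G (fun _ i => X i) a b
  rw [derivation_polarForm]
  have hX : ∀ c : Fin n, (fun i => pderiv c (X i : MvPolynomial (Fin n) ℚ)) = Pi.single c 1 := by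
    intro c
    funext i
    rw [pderiv_X, Pi.single_apply]
  simp only [hX, map_sum, derivation_polarForm]
  have key : ∀ k l : Fin (e + 2), polarForm G (e + 2) (Function.update
      (Function.update (fun _ i => (X i : MvPolynomial (Fin n) ℚ)) k (Pi.single b 1)) l fun i =>
        pderiv a (Function.update (fun _ i => (X i : MvPolynomial (Fin n) ℚ)) k
          (Pi.single b 1) l i)) = if l = k then 0 else P := by
    intro k l
    split_ifs with hlk
    · subst hlk
      rw [polarForm_update]
      have : ∀ i, pderiv a ((Pi.single b 1 : Fin n → MvPolynomial (Fin n) ℚ) i) = 0 := by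
        intro i
        rw [Pi.single_apply]
        split_ifs <;> simp
      simp [this]
    · obtain ⟨s, hs1, hs2⟩ := exists_perm_apply_eq (p := (Fin.last e).castSucc)
        (q := Fin.last (e + 1)) (k := k) (l := l) (Fin.castSucc_lt_last _).ne (Ne.symm hlk)
      rw [Function.update_of_ne hlk, hX, ← polarForm_comp_perm G _ s]
      simp only [P, polarMatrix, Matrix.of_apply]
      congr 1
      funext c
      rw [Function.comp_apply]
      refine Fin.lastCases ?_ (fun c => Fin.lastCases ?_ (fun c => ?_) c) c
      · rw [hs2, Function.update_self, Fin.snoc_last]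
      · rw [hs1, Function.update_of_ne (Ne.symm hlk), Function.update_self, Fin.snoc_castSucc,
          Fin.snoc_last]
      · rw [Function.update_of_ne, Function.update_of_ne, Fin.snoc_castSucc, Fin.snoc_castSucc]
        · rw [← hs1]
          exact fun h => (Fin.castSucc_lt_last c).ne (Fin.castSucc_injective _ (s.injective h))
        · rw [← hs2]
          exact fun h => (Fin.castSucc_lt_last _).ne (s.injective h)
  simp only [key]
  have hrow : ∀ k : Fin (e + 2), ∑ l, (if l = k then 0 else P) = (e + 1) • P := by
    intro k
    rw [Finset.sum_ite, Finset.sum_const_zero, zero_add, Finset.sum_const, Finset.filter_ne' ,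
      Finset.card_erase_of_mem (Finset.mem_univ k)]
    simp
  rw [Finset.sum_congr rfl fun k _ => hrow k, Finset.sum_const, smul_smul]
  simp

theorem smul_polarMatrix_diag (G : MvPolynomial (Fin n) ℤ) (hG : G.IsHomogeneous (e + 2))
    (z : Fin n → ℂ) : (((e + 2) * (e + 1) : ℕ) : ℂ) • polarMatrix (e := e) G (fun _ => z) =
      ((e + 2).factorial : ℂ) • hessian G z := by
  ext a b
  have h1 := pderiv_pderiv_polarForm_X (e := e) G a b
  rw [polarForm_X G hG, ← nsmul_eq_mul, map_nsmul, map_nsmul, pderiv_map, pderiv_map] at h1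
  have h2 := congrArg (aeval (R := ℚ) z).toRingHom h1
  have h3 := congrFun₂ (map_polarMatrix (e := e) G (aeval (R := ℚ) z).toRingHom fun _ i => X i) a b
  rw [map_nsmul, map_nsmul, ← Matrix.map_apply (f := (aeval (R := ℚ) z).toRingHom), h3] at h2
  simp only [AlgHom.toRingHom_eq_coe, RingHom.coe_coe, aeval_X, nsmul_eq_mul] at h2
  rw [Matrix.smul_apply, Matrix.smul_apply, smul_eq_mul, smul_eq_mul, hessian, Matrix.of_apply,
    ← h2]
  congr 1
  exact aeval_map_algebraMap (R := ℤ) ℚ z (pderiv a (pderiv b G))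

theorem rank_polarMatrix_diag (G : MvPolynomial (Fin n) ℤ) (hG : G.IsHomogeneous (e + 2))
    (z : Fin n → ℂ) : (polarMatrix (e := e) G fun _ => z).rank = (hessian G z).rank := by
  have h := congrArg Matrix.rank (smul_polarMatrix_diag G hG z)
  rwa [Matrix.rank_smul_of_mem_nonZeroDivisors, Matrix.rank_smul_of_mem_nonZeroDivisors] at h
  · exact mem_nonZeroDivisors_of_ne_zero (Nat.cast_ne_zero.2 (Nat.factorial_ne_zero _))
  · exact mem_nonZeroDivisors_of_ne_zero (Nat.cast_ne_zero.2 (by positivity))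

end PolarMatrix

/-! ### Tuples at which the polar matrix has small rank -/

section RankLocus

variable {n d : ℕ}

theorem aeval_smul_of_isHomogeneous {σ R S : Type*} [Fintype σ] [CommSemiring R] [CommSemiring S]
    [Algebra R S] {p : MvPolynomial σ R} {k : ℕ} (hp : p.IsHomogeneous k) (t : S) (z : σ → S) :
    aeval (t • z) p = t ^ k * aeval z p := by
  simp only [aeval_def, eval₂_eq', Finset.mul_sum]
  refine Finset.sum_congr rfl fun β hβ => ?_
  have hk : ∑ i, β i = k := by
    rw [hp.degree_eq_sum_deg_support hβ, ← Finsupp.degree_apply, Finsupp.degree_eq_sum]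
  simp only [Pi.smul_apply, smul_eq_mul, mul_pow, Finset.prod_mul_distrib,
    Finset.prod_pow_eq_pow_sum, hk]
  ring

theorem smul_mem_rankLocus (G : MvPolynomial (Fin n) ℤ) (hG : G.IsHomogeneous d) {r : ℕ} (t : ℂ)
    {z : Fin n → ℂ} (hz : z ∈ rankLocus G r) : t • z ∈ rankLocus G r := by
  have h : hessian G (t • z) = (Matrix.scalar (Fin n) (t ^ (d - 2))) * hessian G z := by
    ext i j
    rw [Matrix.scalar_apply, Matrix.diagonal_mul]
    exact aeval_smul_of_isHomogeneous (isHomogeneous_hessian G hG i j) t z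
  rw [rankLocus, Set.mem_ofPred_eq, h]
  exact (Matrix.rank_mul_le_right _ _).trans hz

theorem exists_linear_forms_rankLocus (G : MvPolynomial (Fin n) ℤ) (hG : G.IsHomogeneous d)
    {r m : ℕ} (h : algDim (rankLocus G r) ≤ (m : WithBot ℕ∞)) :
    ∃ l : Fin m → MvPolynomial (Fin n) ℂ, (∀ i, (l i).IsHomogeneous 1) ∧
      ∀ z ∈ rankLocus G r, (∀ i, eval z (l i) = 0) → z = 0 := by
  obtain ⟨l, hl, hdim⟩ := exists_linear_forms_ringKrullDim_le_zero m _ h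
  refine ⟨l, hl, fun z hz hlz => eq_zero_of_ringKrullDim_le_zero hdim fun t p hp => ?_⟩
  have hle : vanishingIdeal ℂ (rankLocus G r) ⊔ Ideal.span (Set.range l) ≤
      RingHom.ker (eval (t • z)) := by
    refine sup_le (fun q hq => ?_) (Ideal.span_le.2 ?_)
    · have := hq _ (smul_mem_rankLocus G hG t hz)
      simpa [aeval_eq_eval] using this
    · rintro _ ⟨i, rfl⟩
      have := aeval_smul_of_isHomogeneous (hl i) t z
      simp only [aeval_eq_eval] at this
      change eval (t • z) (l i) = 0
      simpa [hlz i] using this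
  exact hle hp

/-- The number of points of a grid at which the polar matrix has rank at most `r`. -/
theorem exists_card_rank_polarMatrix_le (n e r m : ℕ) :
    ∃ C : ℕ, ∀ G : MvPolynomial (Fin n) ℤ, G.IsHomogeneous (e + 1 + 2) →
      algDim (rankLocus G r) ≤ (m : WithBot ℕ∞) → ∀ (S : Finset ℂ), S.Nonempty →
        ∀ Y : Finset (Fin (e + 1) → Fin n → ℂ), (∀ x ∈ Y, ∀ k i, x k i ∈ S) →
          (∀ x ∈ Y, (polarMatrix G x).rank ≤ r) → Y.card ≤ C * S.card ^ (e * n + m) := by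
  classical
  obtain ⟨C, hC⟩ := exists_card_le_mul_pow (Fin (e + 1) × Fin n)
    ((Fin (r + 1) → Fin n) × (Fin (r + 1) → Fin n)) ((Fin e × Fin n) ⊕ Fin m) ℂ
    fun _ => (r + 1) * (e + 1)
  refine ⟨C, fun G hG hdim S hS Y hYS hYr => ?_⟩
  obtain ⟨l, hl, hlz⟩ := exists_linear_forms_rankLocus G hG hdim
  let A : Matrix (Fin n) (Fin n) (MvPolynomial (Fin (e + 1) × Fin n) ℂ) :=
    polarMatrix G fun k i => X (k, i)
  let f : (Fin (r + 1) → Fin n) × (Fin (r + 1) → Fin n) → MvPolynomial (Fin (e + 1) × Fin n) ℂ :=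
    fun s => (A.submatrix s.1 s.2).det
  -- The `e * n` equations of the diagonal, followed by the `m` hyperplanes that cut the rank locus,
  -- read in block 0, down to the origin.
  let l' : (Fin e × Fin n) ⊕ Fin m → MvPolynomial (Fin (e + 1) × Fin n) ℂ :=
    Sum.elim (fun p => X (p.1.succ, p.2) - X (0, p.2)) fun j => rename (fun i => (0, i)) (l j)
  have hA : ∀ x : Fin (e + 1) × Fin n → ℂ, A.map (eval x) = polarMatrix G fun k i => x (k, i) := by
    intro x
    rw [map_polarMatrix]
    simp only [eval_X]
  have hfeval : ∀ x s, eval x (f s) =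
      ((polarMatrix G fun k i => x (k, i)).submatrix s.1 s.2).det := by
    intro x s
    rw [RingHom.map_det, ← hA]
    rfl
  have hf : ∀ s, (f s).IsHomogeneous ((r + 1) * (e + 1)) := by
    intro s
    simp only [f, Matrix.det_apply]
    refine IsHomogeneous.sum _ _ _ fun σ _ => ?_
    have := IsHomogeneous.prod (Finset.univ : Finset (Fin (r + 1)))
      (fun i => A.submatrix s.1 s.2 (σ i) i) (fun _ => e + 1)
      fun i _ => isHomogeneous_polarMatrix G _ _
    rw [Finset.sum_const, Finset.card_univ, Fintype.card_fin, smul_eq_mul] at this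
    rcases Int.units_eq_one_or (Equiv.Perm.sign σ) with h | h
    · simpa [h] using this
    · simpa [h] using this.neg
  have hl' : ∀ i, (l' i).IsHomogeneous 1 := by
    rintro (p | j)
    · exact (isHomogeneous_X _ _).sub (isHomogeneous_X _ _)
    · exact (hl j).rename_isHomogeneous
  have h0 : ∀ x, (∀ s, eval x (f s) = 0) → (∀ i, eval x (l' i) = 0) → x = 0 := by
    intro x hx hxl
    have hconst : ∀ k i, x (k, i) = x (0, i) := by
      intro k i
      refine Fin.cases rfl (fun k => ?_) k
      have := hxl (Sum.inl (k, i))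
      simpa [l', sub_eq_zero] using this
    have hrank : (polarMatrix G fun k i => x (k, i)).rank ≤ r := by
      rw [rank_le_iff_forall_det_submatrix_eq_zero]
      intro s t
      rw [← hx (s, t), hfeval]
    have hdiag : (fun (k : Fin (e + 1)) i => x (k, i)) = fun _ i => x (0, i) := by
      funext k i
      exact hconst k i
    rw [hdiag, rank_polarMatrix_diag G hG] at hrank
    have hz := hlz (fun i => x (0, i)) hrank fun j => by
      have := hxl (Sum.inr j)
      simp only [l', Sum.elim_inr, eval_rename] at this
      exact this
    funext ⟨k, i⟩
    rw [hconst]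
    exact congrFun hz i
  let u : (Fin (e + 1) → Fin n → ℂ) → (Fin (e + 1) × Fin n → ℂ) := fun x p => x p.1 p.2
  have hu : Function.Injective u := fun x y h => by
    funext k i
    exact congrFun h (k, i)
  have := hC f l' hf hl' h0 S (Y.image u) hS
    (by
      intro y hy i
      obtain ⟨x, hx, rfl⟩ := Finset.mem_image.1 hy
      exact hYS x hx _ _)
    (by
      intro y hy s
      obtain ⟨x, hx, rfl⟩ := Finset.mem_image.1 hy
      rw [hfeval]
      exact (rank_le_iff_forall_det_submatrix_eq_zero _ _).1 (hYr x hx) _ _)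
  rw [Finset.card_image_of_injective _ hu] at this
  simpa using this

end RankLocus

/-! ### Summing over the rank -/

section SolutionCount

variable {n e : ℕ}

/-- The vectors with entries in `S`. -/
abbrev gridVectors (n : ℕ) (S : Finset ℂ) : Finset (Fin n → ℂ) := Fintype.piFinset fun _ => S

open Classical in
theorem card_filter_polarMatrix_mulVec_le (G : MvPolynomial (Fin n) ℤ) (S : Finset ℂ) :
    (((Fintype.piFinset fun _ : Fin e => gridVectors n S) ×ˢ gridVectors n S).filter fun p =>
      (polarMatrix G p.1).mulVec p.2 = 0).card ≤
    ∑ r ∈ Finset.range (n + 1), ((Fintype.piFinset fun _ : Fin e => gridVectors n S).filter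
      fun x => (polarMatrix G x).rank = r).card * S.card ^ (n - r) := by
  rw [Finset.card_filter, Finset.sum_product]
  simp only [← Finset.card_filter]
  have hmaps : ∀ x ∈ Fintype.piFinset fun _ : Fin e => gridVectors n S,
      (polarMatrix G x).rank ∈ Finset.range (n + 1) := fun x _ =>
    Finset.mem_range_succ_iff.2 (Matrix.rank_le_width _)
  rw [← Finset.sum_fiberwise_of_maps_to hmaps]
  refine Finset.sum_le_sum fun r _ => ?_
  rw [← smul_eq_mul]
  refine Finset.sum_le_card_nsmul _ _ _ fun x hx => ?_
  have := card_filter_mulVec_eq_zero_le (polarMatrix G x) S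
  rw [(Finset.mem_filter.1 hx).2, Fintype.card_fin] at this
  convert this

theorem polarMatrix_mulVec_eq_zero_of_mem_solutionSet (G : MvPolynomial (Fin n) ℤ) {B : ℝ}
    {x : Fin (e + 1) → Fin n → ℤ} (hx : x ∈ solutionSet G (e + 2) B) :
    (polarMatrix G fun (k : Fin e) i => (x k.castSucc i : ℂ)).mulVec
      (fun i => (x (Fin.last e) i : ℂ)) = 0 := by
  funext a
  rw [polarMatrix_mulVec, Pi.zero_apply, ← map_zero (algebraMap ℚ ℂ), ← hx.2 a, map_polarForm]
  congr 1
  funext k i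
  refine Fin.lastCases ?_ (fun k => Fin.lastCases ?_ (fun k => ?_) k) k
  · simp [withBasisVec, Pi.single_apply]
  · simp [withBasisVec]
    rfl
  · have hk : (k : ℕ) < e + 1 := by omega
    simp [withBasisVec, hk]
    rfl

/-- The integers in `[-B, B]`, as complex numbers. -/
noncomputable def intervalGrid (B : ℝ) : Finset ℂ :=
  (Finset.Icc (-⌊B⌋) ⌊B⌋).image fun a : ℤ => (a : ℂ)

theorem intervalGrid_nonempty {B : ℝ} (hB : 1 ≤ B) : (intervalGrid B).Nonempty := by
  have : 0 ≤ ⌊B⌋ := Int.floor_nonneg.2 (by linarith)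
  exact Finset.Nonempty.image ⟨0, Finset.mem_Icc.2 ⟨by omega, this⟩⟩ _

theorem card_intervalGrid_le {B : ℝ} (hB : 1 ≤ B) : ((intervalGrid B).card : ℝ) ≤ 3 * B := by
  have h0 : 0 ≤ ⌊B⌋ := Int.floor_nonneg.2 (by linarith)
  have h1 : ((intervalGrid B).card : ℤ) ≤ 2 * ⌊B⌋ + 1 := by
    have h := Finset.card_image_le (s := Finset.Icc (-⌊B⌋) ⌊B⌋) (f := fun a : ℤ => (a : ℂ))
    rw [Int.card_Icc] at h
    change (intervalGrid B).card ≤ _ at h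
    omega
  have h2 : ((intervalGrid B).card : ℝ) ≤ 2 * ⌊B⌋ + 1 := by exact_mod_cast h1
  have := Int.floor_le B
  linarith

theorem cast_mem_intervalGrid {B : ℝ} {a : ℤ} (h : -B ≤ a ∧ (a : ℝ) ≤ B) :
    (a : ℂ) ∈ intervalGrid B := by
  refine Finset.mem_image_of_mem _ (Finset.mem_Icc.2 ⟨?_, Int.le_floor.2 h.2⟩)
  rw [neg_le]
  exact Int.le_floor.2 (by push_cast; linarith [h.1])

open Classical in
theorem ncard_solutionSet_le (G : MvPolynomial (Fin n) ℤ) (B : ℝ) :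
    (solutionSet G (e + 2) B).ncard ≤ ∑ r ∈ Finset.range (n + 1),
      ((Fintype.piFinset fun _ : Fin e => gridVectors n (intervalGrid B)).filter
        fun x => (polarMatrix G x).rank = r).card * (intervalGrid B).card ^ (n - r) := by
  refine le_trans ?_ (card_filter_polarMatrix_mulVec_le G (intervalGrid B))
  -- The last vector of a solution is split off, to play the role of the kernel vector.
  rw [← Set.ncard_coe_finset]
  refine Set.ncard_le_ncard_of_injOn (fun x : Fin (e + 1) → Fin n → ℤ =>
    ((fun (k : Fin e) i => (x k.castSucc i : ℂ)), fun i => (x (Fin.last e) i : ℂ))) ?_ ?_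
    (Finset.finite_toSet _)
  · intro x hx
    refine Finset.mem_filter.2 ⟨Finset.mem_product.2 ⟨?_, ?_⟩,
      polarMatrix_mulVec_eq_zero_of_mem_solutionSet G hx⟩
    · exact Fintype.mem_piFinset.2 fun k => Fintype.mem_piFinset.2 fun i =>
        cast_mem_intervalGrid (hx.1 _ _)
    · exact Fintype.mem_piFinset.2 fun i => cast_mem_intervalGrid (hx.1 _ _)
  · intro x _ y _ hxy
    obtain ⟨h1, h2⟩ := Prod.mk.inj hxy
    funext k i
    refine Fin.lastCases ?_ (fun k => ?_) k
    · exact_mod_cast congrFun h2 i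
    · exact_mod_cast congrFun₂ h1 k i

-- Passes from powers of the grid size, which is at most `3 * B`, to powers of `B`. The exponent `k`
-- may vary with `r` and with `G`; the bound `N` keeps the factor `3 ^ k` uniform, and `k ≤ E`
-- suffices since `1 ≤ B`.
open Classical in
theorem ncard_solutionSet_le_of_forall (G : MvPolynomial (Fin n) ℤ) {B : ℝ} (hB : 1 ≤ B) {E : ℤ}
    {C N : ℕ} (h : ∀ r ≤ n, ∃ k : ℕ, (k : ℤ) ≤ E ∧ k ≤ N ∧
      ((Fintype.piFinset fun _ : Fin e => gridVectors n (intervalGrid B)).filter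
        fun x => (polarMatrix G x).rank = r).card * (intervalGrid B).card ^ (n - r) ≤
      C * (intervalGrid B).card ^ k) :
    ((solutionSet G (e + 2) B).ncard : ℝ) ≤ (n + 1) * (C * 3 ^ N) * B ^ E := by
  have h1 : ((solutionSet G (e + 2) B).ncard : ℝ) ≤ _ := Nat.cast_le.2 (ncard_solutionSet_le G B)
  refine h1.trans ?_
  rw [Nat.cast_sum]
  refine (Finset.sum_le_card_nsmul _ _ (C * 3 ^ N * B ^ E) fun r hr => ?_).trans ?_
  · obtain ⟨k, hkE, hkN, hk⟩ := h r (Finset.mem_range_succ_iff.1 hr)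
    have hk' : (_ : ℝ) ≤ ((C * (intervalGrid B).card ^ k : ℕ) : ℝ) := Nat.cast_le.2 hk
    refine hk'.trans ?_
    push_cast
    rw [mul_assoc]
    refine mul_le_mul_of_nonneg_left ?_ (Nat.cast_nonneg _)
    calc ((intervalGrid B).card : ℝ) ^ k ≤ (3 * B) ^ k :=
          pow_le_pow_left₀ (Nat.cast_nonneg _) (card_intervalGrid_le hB) k
      _ = 3 ^ k * B ^ (k : ℤ) := by rw [mul_pow, zpow_natCast]
      _ ≤ 3 ^ N * B ^ E := mul_le_mul (pow_le_pow_right₀ (by norm_num) hkN)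
          (zpow_le_zpow_right₀ hB hkE) (by positivity) (by positivity)
  · rw [Finset.card_range, nsmul_eq_mul]
    push_cast
    exact le_of_eq (by ring)

end SolutionCount

/-! ### The cases d = 2 and d > 2 -/

section Main

theorem exists_ncard_solutionSet_le_two (n : ℕ) :
    ∃ C : ℝ, 0 < C ∧ ∀ G : MvPolynomial (Fin n) ℤ, G.IsHomogeneous 2 → ∀ B : ℝ, 1 ≤ B →
      ((solutionSet G 2 B).ncard : ℝ) ≤ C * B ^ (((2 : ℕ) - 2 : ℤ) * n + hessDefect G 2) := by
  classical
  refine ⟨(n + 1) * ((1 : ℕ) * 3 ^ n), by positivity, fun G hG B hB =>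
    ncard_solutionSet_le_of_forall (e := 0) G hB fun r hr => ?_⟩
  have hrank : ∀ x : Fin 0 → Fin n → ℂ, (polarMatrix G x).rank = (hessian G 0).rank := fun x => by
    rw [← rank_polarMatrix_diag (e := 0) G hG, Subsingleton.elim x]
  have hle : (hessian G 0).rank ≤ n := Matrix.rank_le_width _
  refine ⟨n - (hessian G 0).rank, ?_, Nat.sub_le _ _, ?_⟩
  · simp [hessDefect, Nat.cast_sub hle]
  · simp only [hrank]
    -- With no arguments to fix there is one matrix, so only the term with `r` equal to its rank
    -- contributes.
    by_cases hr' : (hessian G 0).rank = r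
    · simp [hr']
    · simp [hr']

theorem exists_ncard_solutionSet_le_of_two_lt (n e : ℕ) :
    ∃ C : ℝ, 0 < C ∧ ∀ G : MvPolynomial (Fin n) ℤ, G.IsHomogeneous (e + 3) → ∀ B : ℝ, 1 ≤ B →
      ((solutionSet G (e + 3) B).ncard : ℝ) ≤
        C * B ^ (((e + 3 : ℕ) - 2 : ℤ) * n + hessDefect G (e + 3)) := by
  classical
  choose c hc using exists_card_rank_polarMatrix_le n e
  -- Summing over all possible dimensions `m ≤ n` as well as all ranks removes the dependence on
  -- `G`, which enters only through `m`.
  let C : ℕ := ∑ r ∈ Finset.range (n + 1), ∑ m ∈ Finset.range (n + 1), c r m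
  have hcC : ∀ r ≤ n, ∀ m ≤ n, c r m ≤ C := fun r hr m hm =>
    (Finset.single_le_sum (f := fun m => c r m) (fun _ _ => Nat.zero_le _)
      (Finset.mem_range_succ_iff.2 hm)).trans
      (Finset.single_le_sum (f := fun r => ∑ m ∈ Finset.range (n + 1), c r m)
        (fun _ _ => Nat.zero_le _) (Finset.mem_range_succ_iff.2 hr))
  refine ⟨(n + 1) * ((C + 1 : ℕ) * 3 ^ ((e + 2) * n)), by positivity, fun G hG B hB =>
    ncard_solutionSet_le_of_forall (e := e + 1) G hB fun r hr => ?_⟩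
  obtain ⟨m, hmn, hm⟩ := exists_algDim_rankLocus_eq G hG (by omega) r
  -- `e * n + m` counts the tuples of rank at most `r`, and `n - r` the kernel vectors; the sum is
  -- at most `(e + 2) * n` because `m ≤ n`.
  refine ⟨e * n + m + (n - r), ?_, ?_, ?_⟩
  · have hdef : (m : ℤ) - r ≤ hessDefect G (e + 3) := by
      rw [hessDefect, if_pos (by omega)]
      have := Finset.le_sup' (fun r : ℕ => (((algDim (rankLocus G r)).unbotD 0).toNat : ℤ) - (r : ℤ))
        (Finset.mem_range_succ_iff.2 hr)
      rw [hm] at this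
      exact this
    push_cast [Nat.cast_sub hr]
    linarith
  · have : (e + 2) * n = e * n + n + n := by ring
    omega
  · rw [pow_add, ← mul_assoc]
    refine Nat.mul_le_mul_right _ ?_
    refine (hc r m G hG hm.le (intervalGrid B) (intervalGrid_nonempty hB) _ ?_ ?_).trans
      (Nat.mul_le_mul_right _ ((hcC r hr m hmn).trans (Nat.le_succ C)))
    · intro x hx k i
      exact Fintype.mem_piFinset.1 (Fintype.mem_piFinset.1 (Finset.mem_filter.1 hx).1 k) i
    · intro x hx
      exact (Finset.mem_filter.1 hx).2.le

end Main

end HessianBirch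

theorem lemma2p1 (d n : ℕ) (hd : 2 ≤ d) :
    ∃ C : ℝ, 0 < C ∧ ∀ G : MvPolynomial (Fin n) ℤ, G.IsHomogeneous d → ∀ B : ℝ, 1 ≤ B →
      ((HessianBirch.solutionSet G d B).ncard : ℝ) ≤
        C * B ^ (((d : ℤ) - 2) * (n : ℤ) + HessianBirch.hessDefect G d) := by
  rcases hd.eq_or_lt with rfl | hd
  · exact HessianBirch.exists_ncard_solutionSet_le_two n
  · obtain ⟨e, rfl⟩ := Nat.exists_eq_add_of_le' hd
    exact HessianBirch.exists_ncard_solutionSet_le_of_two_lt n e
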